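/- Let $m,r\ge 0$ be integers, let $U\subseteq\mathbb{R}^m$ be open, let $f:U\to\mathbb{R}^m$ be real analytic, and let $t_0\in\mathbb{R}$, $y_0\in U$. Let $\hat P_j(x)=\sqrt{2j+1}\,P_j(2x-1)$, $j\ge 0$, where $P_j$ is the Legendre polynomial of degree $j$; these are the shifted Legendre polynomials, orthonormal on $[0,1]$. For $h>0$ and a continuous function $u:[t_0,t_0+h]\to U$ put $$\gamma_j(u)=\int_0^1\hat P_j(\tau)\,f(u(t_0+\tau h))\,d\tau .$$ Consider the local initial value problem $$y'=f(y),\quad t\in[t_0,t_0+h],\qquad y(t_0)=y_0, \tag{1}$$ and the problem obtained by truncating the expansion $y'(t_0+ch)=\sum_{j\ge0}\hat P_j(c)\gamma_j(y)$ after $r$ terms, $$\omega'(t_0+ch)=\sum_{j=0}^{r-1}\hat P_j(c)\,\gamma_j(\omega),\quad c\in[0,1],\qquad \omega(t_0)=y_0. \tag{2}$$ Let $K\subseteq U$ be any compact neighbourhood of $y_0$. Then there are $h_0>0$ and $C$ (depending on $m,f,t_0,y_0,r,K$ but not on $h$) such that for every $h\in(0,h_0]$ problem (1) has exactly one solution $y$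 with values in $U$, problem (2) has exactly one solution $\omega$ with values in $K$, this $\omega$ is a polynomial of degree at most $r$ on $[t_0,t_0+h]$, and $$\|y(t_0+h)-\omega(t_0+h)\|\le C\,h^{2r+1};$$ that is, $y(t_0+h)-\omega(t_0+h)=O(h^{2r+1})$ as $h\to0^+$. -/

import Mathlib

open Set

noncomputable section

/-- The shifted Legendre polynomials on `[0,1]`, scaled to be orthonormal in `L²(0,1)`:
`P̂ⱼ(x) = √(2j+1) · Pⱼ(2x - 1)`, with `Pⱼ` the classical Legendre polynomial. Mathlib's
`Polynomial.shiftedLegendre j` is `Pⱼ(1 - 2x) = (-1)ʲ Pⱼ(2x - 1)`, whence the sign. -/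
def legendreHat (j : ℕ) : Polynomial ℝ :=
  Polynomial.C ((-1 : ℝ) ^ j * √(2 * (j : ℝ) + 1)) *
    (Polynomial.shiftedLegendre j).map (Int.castRingHom ℝ)

/-- The Fourier coefficient `γⱼ(u) = ∫₀¹ P̂ⱼ(τ) f(u(t₀ + τ h)) dτ`. -/
def legendreCoeff {m : ℕ} (f : EuclideanSpace ℝ (Fin m) → EuclideanSpace ℝ (Fin m))
    (t₀ h : ℝ) (j : ℕ) (u : ℝ → EuclideanSpace ℝ (Fin m)) : EuclideanSpace ℝ (Fin m) :=
  ∫ τ in (0 : ℝ)..1, (legendreHat j).eval τ • f (u (t₀ + τ * h))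

/-- `y` solves `y' = f(y)` on `[t₀, t₀ + h]`, `y(t₀) = y₀`, with values in the domain `U` of `f`
(one-sided derivatives at the endpoints). -/
structure SolvesIVP {m : ℕ} (f : EuclideanSpace ℝ (Fin m) → EuclideanSpace ℝ (Fin m))
    (U : Set (EuclideanSpace ℝ (Fin m))) (t₀ h : ℝ) (y₀ : EuclideanSpace ℝ (Fin m))
    (y : ℝ → EuclideanSpace ℝ (Fin m)) : Prop where
  initial : y t₀ = y₀
  mapsTo : ∀ t ∈ Icc t₀ (t₀ + h), y t ∈ U
  deriv_eq : ∀ t ∈ Icc t₀ (t₀ + h), HasDerivWithinAt y (f (y t)) (Icc t₀ (t₀ + h)) t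

/-- `ω` solves the problem truncated after `r` terms,
`ω'(t₀ + c h) = ∑_{j < r} P̂ⱼ(c) γⱼ(ω)` for `c ∈ [0,1]`, `ω(t₀) = y₀`, with values in `K`. -/
structure SolvesTruncated {m : ℕ} (f : EuclideanSpace ℝ (Fin m) → EuclideanSpace ℝ (Fin m))
    (K : Set (EuclideanSpace ℝ (Fin m))) (r : ℕ) (t₀ h : ℝ) (y₀ : EuclideanSpace ℝ (Fin m))
    (ω : ℝ → EuclideanSpace ℝ (Fin m)) : Prop where
  initial : ω t₀ = y₀
  mapsTo : ∀ t ∈ Icc t₀ (t₀ + h), ω t ∈ K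
  deriv_eq : ∀ c ∈ Icc (0 : ℝ) 1, HasDerivWithinAt ω
    (∑ j ∈ Finset.range r, (legendreHat j).eval c • legendreCoeff f t₀ h j ω)
    (Icc t₀ (t₀ + h)) (t₀ + c * h)

/-- On `[a, b]` every component of `u` is a polynomial of degree at most `r`. -/
def IsPolynomialOn {m : ℕ} (r : ℕ) (a b : ℝ) (u : ℝ → EuclideanSpace ℝ (Fin m)) : Prop :=
  ∃ p : Fin m → Polynomial ℝ, (∀ i, (p i).natDegree ≤ r) ∧
    ∀ t ∈ Icc a b, ∀ i, u t i = (p i).eval t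

end

/-! Let Π be the `L²(0,1)` projection onto polynomials of degree less than `r`, so that (2) reads
`w' = h Π(f ∘ w)` for `w(c) = ω(t₀ + c h)`. Put `e(c) = w(c) - y(t₀ + c h)` and let `R = f ∘ w - Π(f
∘ w)` be the residual.

Since Π is bounded in the sup norm and fixes polynomials of degree less than `r`, Taylor expansion
of `f ∘ y` and absorption for small `h` give `e = O(h^(r+1))` and `R = O(h^r)` uniformly
(`norm_sub_legendreProj_le`). This alone gives only order `r + 1` at the endpoint.

The extra order comes from duality. Let `Ψ' = -Ψ f'(y)`, `Ψ(t₀) = 1`. Then `(Ψ e)' = h Ψ (N - R)`,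
where `N`, the remainder of linearizing `f` at `y`, is quadratic in `e`. Replace `Ψ` in `Ψ R` by its
Taylor polynomial `P` of degree less than `r`: the error `(Ψ - P) R` is `O(h^(2r))`, while `P R`
integrates to zero over `[0,1]` because `R` is orthogonal to low-degree polynomials
(`integral_sum_pow_smul_apply_sub_legendreProj`). The factor `h` in front gives `h^(2r+1)`, and `Ψ`
is invertible with bounded inverse (`exists_norm_sub_le_pow`).

Existence for (2) is a contraction argument for its `r` coefficients
(`exists_legendre_coefficients`). -/

/-! ### Orthonormality and completeness of the Legendre polynomials. -/

open Polynomial in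
theorem Polynomial.intervalIntegrable_eval (p : ℝ[X]) (a b : ℝ) :
    IntervalIntegrable (fun x => p.eval x) MeasureTheory.volume a b :=
  p.continuous.intervalIntegrable a b

open Polynomial in
theorem Polynomial.integral_eval_derivative (p : ℝ[X]) :
    ∫ x in (0 : ℝ)..1, (derivative p).eval x = p.eval 1 - p.eval 0 :=
  intervalIntegral.integral_eq_sub_of_hasDerivAt (fun x _ => p.hasDerivAt x)
    (intervalIntegrable_eval _ _ _)

open Polynomial in
theorem Polynomial.integral_eval_derivative_mul (p q : ℝ[X]) (h0 : p.eval 0 = 0)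
    (h1 : p.eval 1 = 0) :
    ∫ x in (0 : ℝ)..1, (derivative p * q).eval x =
      -∫ x in (0 : ℝ)..1, (p * derivative q).eval x := by
  have h := integral_eval_derivative (p * q)
  rw [derivative_mul] at h
  simp only [eval_add] at h
  rw [intervalIntegral.integral_add (intervalIntegrable_eval _ _ _)
    (intervalIntegrable_eval _ _ _)] at h
  simp only [eval_mul, h0, h1] at h ⊢
  linarith

open Polynomial in
theorem Polynomial.integral_eval_iterate_derivative_mul (n : ℕ) (p q : ℝ[X])
    (h0 : ∀ k < n, (derivative^[k] p).eval 0 = 0) (h1 : ∀ k < n, (derivative^[k] p).eval 1 = 0) :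
    ∫ x in (0 : ℝ)..1, (derivative^[n] p * q).eval x =
      (-1) ^ n * ∫ x in (0 : ℝ)..1, (p * derivative^[n] q).eval x := by
  induction n generalizing q with
  | zero => simp
  | succ n ih =>
    rw [Function.iterate_succ_apply', integral_eval_derivative_mul _ _ (h0 n (by simp))
      (h1 n (by simp)), ih _ (fun k hk => h0 k (by omega)) (fun k hk => h1 k (by omega)),
      ← Function.iterate_succ_apply]
    ring

-- Beta integral, needed for the normalization. Since `X ^ (a + 1) * (1 - X) ^ (b + 1)` vanishes at
-- both endpoints, integrating its derivative trades a factor `1 - X` for a factor `X`.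
open Polynomial Nat in
theorem Polynomial.integral_eval_X_pow_mul_one_sub_X_pow (a b : ℕ) :
    ∫ x in (0 : ℝ)..1, ((X : ℝ[X]) ^ a * (1 - X) ^ b).eval x =
      (a ! : ℝ) * (b ! : ℝ) / ((a + b + 1)! : ℝ) := by
  induction b generalizing a with
  | zero =>
    have : (a ! : ℝ) ≠ 0 := by positivity
    simp [Nat.factorial_succ]; field_simp
  | succ b ih =>
    have hd : derivative ((X : ℝ[X]) ^ (a + 1)) = C ((a : ℝ) + 1) * X ^ a := by
      simp
    have h := integral_eval_derivative ((X : ℝ[X]) ^ (a + 1) * (1 - X) ^ (b + 1))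
    have e : derivative ((X : ℝ[X]) ^ (a + 1) * (1 - X) ^ (b + 1)) =
        C ((a : ℝ) + 1) * (X ^ a * (1 - X) ^ (b + 1))
          - C ((b : ℝ) + 1) * (X ^ (a + 1) * (1 - X) ^ b) := by
      rw [derivative_mul, hd, derivative_pow]; simp; ring
    rw [e] at h
    simp only [eval_sub] at h
    rw [intervalIntegral.integral_sub (intervalIntegrable_eval _ _ _)
      (intervalIntegrable_eval _ _ _)] at h
    simp only [eval_C_mul, intervalIntegral.integral_const_mul, ih (a + 1)] at h
    simp only [eval_mul, eval_pow, eval_sub, eval_X, eval_one] at h ⊢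
    have ha : ((a : ℝ) + 1) ≠ 0 := by positivity
    have hf : (((a + 1 + b + 1)! : ℕ) : ℝ) ≠ 0 := by positivity
    have h3 : a + (b + 1) + 1 = a + 1 + b + 1 := by ring
    rw [h3, eq_div_iff hf]
    rw [Nat.factorial_succ a] at h
    rw [Nat.factorial_succ b]
    push_cast at h ⊢
    field_simp at h
    simp only [ne_eq, not_false_eq_true, zero_pow, zero_mul, mul_zero, sub_self, add_eq_zero,
      one_ne_zero, and_false] at h
    linarith [(mul_eq_zero.1 h).resolve_left ha]

open Polynomial in
/-- The shifted Legendre polynomial with real coefficients. -/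
noncomputable abbrev shiftedLegendreReal (n : ℕ) : ℝ[X] :=
  (shiftedLegendre n).map (Int.castRingHom ℝ)

open Polynomial Nat in
theorem factorial_mul_shiftedLegendreReal (n : ℕ) :
    C (n ! : ℝ) * shiftedLegendreReal n = derivative^[n] (X ^ n * (1 - X) ^ n) := by
  have h := congrArg (Polynomial.map (Int.castRingHom ℝ)) (factorial_mul_shiftedLegendre_eq n)
  rw [Polynomial.map_mul, ← Polynomial.iterate_derivative_map] at h
  simpa using h

-- Rodrigues' formula and `n` integrations by parts. Boundary terms vanish because a derivative of
-- order `k < n` keeps the factors `X ^ (n - k)` and `(1 - X) ^ (n - k)`.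
open Polynomial Nat in
theorem integral_shiftedLegendreReal_mul (n : ℕ) (q : ℝ[X]) :
    (n ! : ℝ) * ∫ x in (0 : ℝ)..1, (shiftedLegendreReal n * q).eval x =
      (-1) ^ n * ∫ x in (0 : ℝ)..1, (X ^ n * (1 - X) ^ n * derivative^[n] q).eval x := by
  rw [← integral_eval_iterate_derivative_mul, ← factorial_mul_shiftedLegendreReal,
    ← intervalIntegral.integral_const_mul]
  · simp [mul_assoc]
  · intro k hk
    have : (X : ℝ[X]) ^ (n - k) ∣ derivative^[k] (X ^ n * (1 - X) ^ n) :=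
      pow_sub_dvd_iterate_derivative_of_pow_dvd k (dvd_mul_right _ _)
    obtain ⟨s, hs⟩ := this
    simp [hs, Nat.sub_ne_zero_of_lt hk]
  · intro k hk
    have : (1 - X : ℝ[X]) ^ (n - k) ∣ derivative^[k] (X ^ n * (1 - X) ^ n) :=
      pow_sub_dvd_iterate_derivative_of_pow_dvd k (dvd_mul_left _ _)
    obtain ⟨s, hs⟩ := this
    simp [hs, Nat.sub_ne_zero_of_lt hk]

open Polynomial Nat in
theorem integral_shiftedLegendreReal_mul_eq_zero {n : ℕ} {q : ℝ[X]} (hq : q.natDegree < n) :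
    ∫ x in (0 : ℝ)..1, (shiftedLegendreReal n * q).eval x = 0 := by
  have h := integral_shiftedLegendreReal_mul n q
  rw [iterate_derivative_eq_zero hq] at h
  have : (n ! : ℝ) ≠ 0 := by positivity
  simpa [this] using h

open Polynomial Nat in
theorem integral_shiftedLegendreReal_mul_self (n : ℕ) :
    ∫ x in (0 : ℝ)..1, (shiftedLegendreReal n * shiftedLegendreReal n).eval x =
      1 / (2 * n + 1) := by
  have h := integral_shiftedLegendreReal_mul n (shiftedLegendreReal n)
  -- Only the leading coefficient survives `n` derivatives, which leaves a beta integral.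
  have hd : derivative^[n] (shiftedLegendreReal n) =
      C ((-1) ^ n * (n ! : ℝ) * ((n + n).choose n : ℝ)) := by
    ext k
    rw [coeff_iterate_derivative, coeff_map, coeff_shiftedLegendre, coeff_C]
    rcases Nat.eq_zero_or_pos k with rfl | hk
    · simp [Nat.descFactorial_self]; ring
    · simp [hk.ne', Nat.choose_eq_zero_of_lt (show n < k + n by omega)]
  rw [hd] at h
  simp only [mul_comm _ (C _), eval_C_mul, intervalIntegral.integral_const_mul] at h
  simp only [integral_eval_X_pow_mul_one_sub_X_pow] at h
  have h1 : (n ! : ℝ) ≠ 0 := by positivity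
  have h2 : ((n + n).choose n : ℝ) * n ! * n ! = (n + n)! := by
    exact_mod_cast Nat.add_choose_mul_factorial_mul_factorial n n
  have h4 : ((n + n)! : ℝ) ≠ 0 := by positivity
  have h3 : ((-1 : ℝ) ^ n) * (-1) ^ n = 1 := by rw [← mul_pow]; simp
  apply mul_left_cancel₀ h1
  rw [h, Nat.factorial_succ]
  push_cast
  have h5 : ((n : ℝ) + n + 1) ≠ 0 := by positivity
  have h6 : (2 * (n : ℝ) + 1) ≠ 0 := by positivity
  calc _ = ((-1 : ℝ) ^ n * (-1) ^ n) * (((n + n).choose n : ℝ) * n ! * n !) * n ! /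
        (((n : ℝ) + n + 1) * (n + n)!) := by ring
    _ = _ := by rw [h3, h2]; field_simp; ring

open Polynomial in
theorem natDegree_legendreHat (n : ℕ) : (legendreHat n).natDegree = n := by
  have hc : ((-1 : ℝ) ^ n * √(2 * (n : ℝ) + 1)) ≠ 0 := by
    have : 0 < √(2 * (n : ℝ) + 1) := Real.sqrt_pos.2 (by positivity)
    simp [this.ne']
  rw [legendreHat, natDegree_C_mul hc, natDegree_map_eq_of_injective
    (RingHom.injective_int _), natDegree_shiftedLegendre]

open Polynomial in
theorem integral_legendreHat_mul_eq_zero {n : ℕ} {q : ℝ[X]} (hq : q.natDegree < n) :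
    ∫ x in (0 : ℝ)..1, (legendreHat n * q).eval x = 0 := by
  simp only [legendreHat, mul_assoc (C _), eval_C_mul, intervalIntegral.integral_const_mul,
    integral_shiftedLegendreReal_mul_eq_zero hq, mul_zero]

open Polynomial in
theorem integral_legendreHat_mul_self (n : ℕ) :
    ∫ x in (0 : ℝ)..1, (legendreHat n * legendreHat n).eval x = 1 := by
  have e : legendreHat n * legendreHat n =
      C (2 * (n : ℝ) + 1) * (shiftedLegendreReal n * shiftedLegendreReal n) := by
    have : (2 * (n : ℝ) + 1) =
        ((-1 : ℝ) ^ n * √(2 * (n : ℝ) + 1)) * ((-1 : ℝ) ^ n * √(2 * (n : ℝ) + 1)) := by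
      rw [mul_mul_mul_comm, ← mul_pow, Real.mul_self_sqrt (by positivity)]; simp
    conv_rhs => rw [this]
    rw [legendreHat, C_mul (a := _ * _) (b := _ * _)]; ring
  have h6 : (2 * (n : ℝ) + 1) ≠ 0 := by positivity
  rw [e]
  simp only [eval_C_mul, intervalIntegral.integral_const_mul]
  rw [integral_shiftedLegendreReal_mul_self]
  field_simp

open Polynomial in
/-- The first `r` Legendre polynomials reproduce every polynomial of degree less than `r`. -/
theorem sum_integral_legendreHat_mul {r : ℕ} {q : ℝ[X]} (hq : q.degree < r) :
    ∑ j ∈ Finset.range r, C (∫ x in (0 : ℝ)..1, (legendreHat j * q).eval x) * legendreHat j = q := by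
  induction r generalizing q with
  | zero =>
    have : q = 0 := by simpa using hq
    simp [this]
  | succ n ih =>
    set p := legendreHat n with hp
    have hpd : p.natDegree = n := natDegree_legendreHat n
    have hp0 : p.coeff n ≠ 0 := by
      have : p ≠ 0 := by
        intro h0
        have := integral_legendreHat_mul_self n
        rw [← hp, h0] at this
        simp at this
      rw [← hpd]
      exact leadingCoeff_ne_zero.2 this
    -- Subtracting `a` times the top Legendre polynomial kills the coefficient of degree `n`, so the
    -- induction hypothesis applies to `s`.
    set a := q.coeff n / p.coeff n with ha
    set s := q - C a * p with hs
    have hsd : s.degree < n := by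
      rw [degree_lt_iff_coeff_zero]
      intro k hk
      rcases hk.eq_or_lt with rfl | hk
      · simp [hs, ha, hp0]
      · have h1 : q.coeff k = 0 :=
          coeff_eq_zero_of_degree_lt (hq.trans_le (by exact_mod_cast hk))
        have h2 : p.coeff k = 0 := coeff_eq_zero_of_natDegree_lt (by omega)
        simp [hs, h1, h2]
    have hq' : q = s + C a * p := by simp [hs]
    have hI : ∀ j, ∫ x in (0 : ℝ)..1, (legendreHat j * q).eval x =
        (∫ x in (0 : ℝ)..1, (legendreHat j * s).eval x) +
          a * ∫ x in (0 : ℝ)..1, (legendreHat j * p).eval x := by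
      intro j
      rw [← intervalIntegral.integral_const_mul, ← intervalIntegral.integral_add
        (intervalIntegrable_eval _ _ _) ((intervalIntegrable_eval _ _ _).const_mul _)]
      congr 1; ext x; rw [hq']; simp; ring
    have hIn : ∫ x in (0 : ℝ)..1, (p * s).eval x = 0 := by
      rcases eq_or_ne s 0 with h0 | h0
      · simp [h0]
      · exact integral_legendreHat_mul_eq_zero ((natDegree_lt_iff_degree_lt h0).2 hsd)
    rw [Finset.sum_range_succ, hI n, ← hp, hIn, integral_legendreHat_mul_self n]
    conv_rhs => rw [hq', ← ih hsd]
    congr 1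
    · refine Finset.sum_congr rfl fun j hj => ?_
      have hj : j < n := Finset.mem_range.1 hj
      rw [hI j, mul_comm (legendreHat j) p, hp, integral_legendreHat_mul_eq_zero
        (n := n) (by rwa [natDegree_legendreHat])]
      simp
    · simp

/-- The Legendre projection of `g` on polynomials of degree less than `r`, in `L²(0,1)`. -/
noncomputable def legendreProj {E : Type*} [NormedAddCommGroup E] [NormedSpace ℝ E] (r : ℕ)
    (g : ℝ → E) (c : ℝ) : E :=
  ∑ j ∈ Finset.range r, (legendreHat j).eval c • ∫ τ in (0 : ℝ)..1, (legendreHat j).eval τ • g τ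

/-! ### The Legendre projection: sup-norm bound, reproduction, orthogonality of the residual. -/

section legendreProj

variable {E : Type*} [NormedAddCommGroup E] [NormedSpace ℝ E]

theorem exists_abs_legendreHat_le (j : ℕ) :
    ∃ b, 0 ≤ b ∧ ∀ c ∈ Icc (0 : ℝ) 1, |(legendreHat j).eval c| ≤ b := by
  obtain ⟨b, hb⟩ := isCompact_Icc.exists_bound_of_continuousOn
    (f := fun c : ℝ => (legendreHat j).eval c) (s := Icc (0 : ℝ) 1)
    (legendreHat j).continuous.continuousOn
  exact ⟨b, (norm_nonneg _).trans (hb 0 (by simp)), hb⟩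

theorem norm_integral_legendreHat_smul_le {j : ℕ} {b M : ℝ} {g : ℝ → E} (hb : 0 ≤ b)
    (hj : ∀ c ∈ Icc (0 : ℝ) 1, |(legendreHat j).eval c| ≤ b)
    (hg : ∀ τ ∈ Icc (0 : ℝ) 1, ‖g τ‖ ≤ M) :
    ‖∫ τ in (0 : ℝ)..1, (legendreHat j).eval τ • g τ‖ ≤ b * M := by
  have h := intervalIntegral.norm_integral_le_of_norm_le_const (a := (0 : ℝ)) (b := 1)
    (f := fun τ => (legendreHat j).eval τ • g τ) (C := b * M) ?_
  · simpa using h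
  · intro x hx
    rw [uIoc_of_le zero_le_one] at hx
    have hx := Ioc_subset_Icc_self hx
    rw [norm_smul]
    exact mul_le_mul (hj x hx) (hg x hx) (norm_nonneg _) hb

-- The constant depends on `r` alone; it serves as the sup-norm bound of the projection in every
-- later estimate.
variable (E) in
theorem exists_norm_legendreProj_le (r : ℕ) : ∃ B, 0 ≤ B ∧ ∀ (g : ℝ → E) (M : ℝ),
    (∀ τ ∈ Icc (0 : ℝ) 1, ‖g τ‖ ≤ M) → ∀ c ∈ Icc (0 : ℝ) 1, ‖legendreProj r g c‖ ≤ B * M := by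
  choose b hb0 hb using exists_abs_legendreHat_le
  refine ⟨∑ j ∈ Finset.range r, b j * b j,
    Finset.sum_nonneg fun j _ => mul_self_nonneg _, fun g M hg c hc => ?_⟩
  rw [legendreProj, Finset.sum_mul]
  refine (norm_sum_le _ _).trans (Finset.sum_le_sum fun j _ => ?_)
  rw [norm_smul, mul_assoc]
  exact mul_le_mul (hb j c hc) (norm_integral_legendreHat_smul_le (hb0 j) (hb j) hg)
    (norm_nonneg _) (hb0 j)

theorem continuous_legendreProj (r : ℕ) (g : ℝ → E) : Continuous (legendreProj r g) :=
  continuous_finsetSum _ fun j _ => (legendreHat j).continuous.smul continuous_const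

theorem intervalIntegrable_eval_smul (p : Polynomial ℝ) {g : ℝ → E}
    (hg : ContinuousOn g (Icc 0 1)) :
    IntervalIntegrable (fun τ => p.eval τ • g τ) MeasureTheory.volume 0 1 := by
  apply ContinuousOn.intervalIntegrable
  rw [uIcc_of_le zero_le_one]
  exact p.continuous.continuousOn.smul hg

theorem legendreProj_sub (r : ℕ) {g₁ g₂ : ℝ → E} (h₁ : ContinuousOn g₁ (Icc 0 1))
    (h₂ : ContinuousOn g₂ (Icc 0 1)) (c : ℝ) :
    legendreProj r (fun τ => g₁ τ - g₂ τ) c = legendreProj r g₁ c - legendreProj r g₂ c := by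
  simp only [legendreProj, smul_sub, ← Finset.sum_sub_distrib]
  refine Finset.sum_congr rfl fun j _ => ?_
  rw [intervalIntegral.integral_sub (intervalIntegrable_eval_smul _ h₁)
    (intervalIntegrable_eval_smul _ h₂), smul_sub]

theorem legendreProj_congr (r : ℕ) {g₁ g₂ : ℝ → E} (h : EqOn g₁ g₂ (Icc 0 1)) :
    legendreProj r g₁ = legendreProj r g₂ := by
  ext c
  refine Finset.sum_congr rfl fun j _ => ?_
  congr 1
  refine intervalIntegral.integral_congr fun τ hτ => ?_
  rw [uIcc_of_le zero_le_one] at hτ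
  simp only [h hτ]

theorem sum_integral_legendreHat_mul_pow {r i : ℕ} (hi : i < r) (c : ℝ) :
    ∑ j ∈ Finset.range r, (∫ x in (0 : ℝ)..1, (legendreHat j).eval x * x ^ i) *
      (legendreHat j).eval c = c ^ i := by
  have h := congrArg (Polynomial.eval c) (sum_integral_legendreHat_mul (r := r)
    (q := Polynomial.X ^ i) (by rw [Polynomial.degree_X_pow]; exact_mod_cast hi))
  simpa [Polynomial.eval_finsetSum] using h

variable [CompleteSpace E]

theorem legendreProj_sum_pow_smul (r : ℕ) (a : ℕ → E) (c : ℝ) :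
    legendreProj r (fun τ => ∑ i ∈ Finset.range r, τ ^ i • a i) c =
      ∑ i ∈ Finset.range r, c ^ i • a i := by
  have hj : ∀ j, ∫ τ in (0 : ℝ)..1, (legendreHat j).eval τ • ∑ i ∈ Finset.range r, τ ^ i • a i =
      ∑ i ∈ Finset.range r, (∫ x in (0 : ℝ)..1, (legendreHat j).eval x * x ^ i) • a i := by
    intro j
    simp only [Finset.smul_sum, smul_smul]
    rw [intervalIntegral.integral_finsetSum]
    · simp only [intervalIntegral.integral_smul_const]
    · intro i _
      apply Continuous.intervalIntegrable
      exact ((legendreHat j).continuous.mul (continuous_pow i)).smul continuous_const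
  simp only [legendreProj, hj]
  simp only [Finset.smul_sum, smul_smul]
  rw [Finset.sum_comm]
  refine Finset.sum_congr rfl fun i hi => ?_
  rw [← Finset.sum_smul]
  congr 1
  rw [← sum_integral_legendreHat_mul_pow (Finset.mem_range.1 hi) c]
  exact Finset.sum_congr rfl fun j _ => mul_comm _ _

/-- The projection is symmetric for the integral pairing, so it can be moved onto `c ^ i`, which it
fixes. -/
theorem integral_pow_smul_sub_legendreProj {r i : ℕ} (hi : i < r) {g : ℝ → E}
    (hg : ContinuousOn g (Icc 0 1)) :
    ∫ c in (0 : ℝ)..1, c ^ i • (g c - legendreProj r g c) = 0 := by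
  have hX : IntervalIntegrable (fun c : ℝ => c ^ i • g c) MeasureTheory.volume 0 1 := by
    simpa using intervalIntegrable_eval_smul (Polynomial.X ^ i) hg
  have hP : IntervalIntegrable (fun c : ℝ => c ^ i • legendreProj r g c)
      MeasureTheory.volume 0 1 :=
    ((continuous_pow i).smul (continuous_legendreProj r g)).intervalIntegrable _ _
  simp only [smul_sub]
  rw [intervalIntegral.integral_sub hX hP, sub_eq_zero]
  have e1 : ∫ c in (0 : ℝ)..1, c ^ i • legendreProj r g c =
      ∑ j ∈ Finset.range r, (∫ x in (0 : ℝ)..1, (legendreHat j).eval x * x ^ i) •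
        ∫ τ in (0 : ℝ)..1, (legendreHat j).eval τ • g τ := by
    simp only [legendreProj, Finset.smul_sum, smul_smul]
    rw [intervalIntegral.integral_finsetSum]
    · refine Finset.sum_congr rfl fun j _ => ?_
      rw [intervalIntegral.integral_smul_const]
      simp only [mul_comm]
    · intro j _
      apply Continuous.intervalIntegrable
      exact ((continuous_pow i).mul (legendreHat j).continuous).smul continuous_const
  rw [e1]
  simp only [← intervalIntegral.integral_smul]
  rw [← intervalIntegral.integral_finsetSum]
  · refine intervalIntegral.integral_congr fun c _ => ?_
    simp only [smul_smul]
    rw [← Finset.sum_smul, sum_integral_legendreHat_mul_pow hi]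
  · intro j _
    exact (intervalIntegrable_eval_smul _ hg).smul _

/-- The source of superconvergence: orthogonality tested against operator-valued polynomials, to be
used with the Taylor polynomial of the adjoint solution. -/
theorem integral_sum_pow_smul_apply_sub_legendreProj (r : ℕ) (T : ℕ → E →L[ℝ] E) {g : ℝ → E}
    (hg : ContinuousOn g (Icc 0 1)) :
    ∫ c in (0 : ℝ)..1, (∑ i ∈ Finset.range r, c ^ i • T i) (g c - legendreProj r g c) = 0 := by
  have hc : ∀ i, IntervalIntegrable (fun c : ℝ => c ^ i • (g c - legendreProj r g c))
      MeasureTheory.volume 0 1 := fun i => by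
    simpa using intervalIntegrable_eval_smul (Polynomial.X ^ i)
      (hg.sub (continuous_legendreProj r g).continuousOn)
  simp only [FunLike.coe_sum, Finset.sum_apply, FunLike.coe_smul, Pi.smul_apply, ← map_smul]
  rw [intervalIntegral.integral_finsetSum]
  · refine Finset.sum_eq_zero fun i hi => ?_
    rw [ContinuousLinearMap.intervalIntegral_comp_comm _ (hc i),
      integral_pow_smul_sub_legendreProj (Finset.mem_range.1 hi) hg, map_zero]
  · intro i _
    exact ⟨(T i).integrable_comp (hc i).1, (T i).integrable_comp (hc i).2⟩

end legendreProj

/-! ### Smooth local solutions, the adjoint equation and Taylor remainders. -/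

open scoped ContDiff in
theorem exists_ode_solution_contDiffOn {E : Type*} [NormedAddCommGroup E] [NormedSpace ℝ E]
    [CompleteSpace E] {F : E → E} {V : Set E} (hV : IsOpen V) (hF : ContDiffOn ℝ ∞ F V) {x₀ : E}
    (hx₀ : x₀ ∈ V) (t₀ : ℝ) {W : Set E} (hW : W ∈ nhds x₀) :
    ∃ δ, 0 < δ ∧ ∃ x : ℝ → E, x t₀ = x₀ ∧
      (∀ t ∈ Icc t₀ (t₀ + δ), x t ∈ W ∧ x t ∈ V ∧ HasDerivAt x (F (x t)) t) ∧
      ContDiffOn ℝ ∞ x (Icc t₀ (t₀ + δ)) := by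
  have hF1 : ContDiffAt ℝ 1 F x₀ :=
    (hF.contDiffAt (hV.mem_nhds hx₀)).of_le (by exact_mod_cast le_top)
  obtain ⟨x, hx, ε, hε, hd⟩ :=
    hF1.exists_forall_mem_closedBall_exists_eq_forall_mem_Ioo_hasDerivAt₀ t₀
  have hc : ContinuousAt x t₀ := (hd t₀ ⟨by linarith, by linarith⟩).continuousAt
  have hVW : V ∩ W ∈ nhds (x t₀) := by
    rw [hx]; exact Filter.inter_mem (hV.mem_nhds hx₀) hW
  obtain ⟨η, hη, hball⟩ := Metric.mem_nhds_iff.1 (hc hVW)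
  refine ⟨min ε η / 2, by positivity, x, hx, ?_⟩
  have key : ∀ t ∈ Icc t₀ (t₀ + min ε η / 2),
      x t ∈ W ∧ x t ∈ V ∧ HasDerivAt x (F (x t)) t := by
    intro t ht
    have h1 := min_le_left ε η
    have h2 := min_le_right ε η
    have h3 : 0 < min ε η := by positivity
    have hb : t ∈ Metric.ball t₀ η := by
      rw [Metric.mem_ball, Real.dist_eq, abs_lt]
      constructor <;> linarith [ht.1, ht.2]
    exact ⟨(hball hb).2, (hball hb).1, hd t ⟨by linarith [ht.1], by linarith [ht.2]⟩⟩
  refine ⟨key, ?_⟩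
  exact ODE.contDiffOn_enat_Icc_of_hasDerivWithinAt (n := ⊤) (f := fun _ => F) (u := V)
    (hF.comp contDiffOn_snd fun p hp => hp.2)
    (fun t ht => (key t ht).2.2.hasDerivWithinAt) (fun t ht => (key t ht).2.1)

open scoped ContDiff in
/-- A solution of an autonomous equation, together with the solution of the adjoint of the
variational equation along it. -/
theorem exists_ode_solution_adjoint {E : Type*} [NormedAddCommGroup E] [NormedSpace ℝ E]
    [CompleteSpace E] {f : E → E} {U : Set E} (hU : IsOpen U) (hf : ContDiffOn ℝ ∞ f U) {y₀ : E}
    (hy₀ : y₀ ∈ U) (t₀ : ℝ) {W : Set E} (hW : W ∈ nhds y₀) :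
    ∃ δ, 0 < δ ∧ ∃ (y : ℝ → E) (Ψ : ℝ → E →L[ℝ] E), y t₀ = y₀ ∧
      (∀ t ∈ Icc t₀ (t₀ + δ), y t ∈ W ∧ y t ∈ U ∧ HasDerivAt y (f (y t)) t ∧
        ‖Ψ t - 1‖ ≤ 1 / 2 ∧ HasDerivAt Ψ (-(Ψ t ∘L fderiv ℝ f (y t))) t) ∧
      ContDiffOn ℝ ∞ y (Icc t₀ (t₀ + δ)) ∧ ContDiffOn ℝ ∞ Ψ (Icc t₀ (t₀ + δ)) := by
  -- The pair `(y, Ψ)` solves one autonomous smooth system, so a single local existence result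
  -- yields both. Confining `Ψ` to the ball of radius `1 / 2` about the identity bounds it and its
  -- inverse by `2`.
  have hF : ContDiffOn ℝ ∞ (fun p : E × (E →L[ℝ] E) => (f p.1, -(p.2 ∘L fderiv ℝ f p.1)))
      (U ×ˢ univ) := by
    refine (hf.comp contDiffOn_fst fun p hp => hp.1).prodMk (ContDiffOn.neg ?_)
    refine contDiffOn_snd.clm_comp ?_
    exact (hf.fderiv_of_isOpen (m := ∞) hU (by simp)).comp contDiffOn_fst fun p hp => hp.1
  have hW' : W ×ˢ Metric.closedBall (1 : E →L[ℝ] E) (1 / 2) ∈ nhds (y₀, (1 : E →L[ℝ] E)) :=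
    prod_mem_nhds hW (Metric.closedBall_mem_nhds _ (by norm_num))
  obtain ⟨δ, hδ, x, hx, hsol, hsm⟩ := exists_ode_solution_contDiffOn
    (hU.prod isOpen_univ) hF (x₀ := (y₀, (1 : E →L[ℝ] E))) ⟨hy₀, mem_univ _⟩ t₀ hW'
  refine ⟨δ, hδ, fun t => (x t).1, fun t => (x t).2, by simp [hx], fun t ht => ?_,
    contDiff_fst.comp_contDiffOn hsm, contDiff_snd.comp_contDiffOn hsm⟩
  obtain ⟨h1, h2, h3⟩ := hsol t ht
  refine ⟨h1.1, h2.1, ?_, mem_closedBall_iff_norm.1 h1.2, ?_⟩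
  · exact hasFDerivAt_fst.comp_hasDerivAt t h3
  · exact hasFDerivAt_snd.comp_hasDerivAt t h3

open scoped ContDiff in
theorem ContDiffOn.exists_norm_sub_sum_pow_smul_le {E : Type*} [NormedAddCommGroup E]
    [NormedSpace ℝ E] {g : ℝ → E} {t₀ δ : ℝ} (hδ : 0 ≤ δ)
    (hg : ContDiffOn ℝ ∞ g (Icc t₀ (t₀ + δ))) (r : ℕ) :
    ∃ C, 0 ≤ C ∧ ∃ a : ℕ → E, ∀ s ∈ Icc 0 δ,
      ‖g (t₀ + s) - ∑ i ∈ Finset.range r, s ^ i • a i‖ ≤ C * s ^ r := by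
  have hab : t₀ ≤ t₀ + δ := by linarith
  have hmem : ∀ s ∈ Icc 0 δ, t₀ + s ∈ Icc t₀ (t₀ + δ) := fun s hs =>
    ⟨by linarith [hs.1], by linarith [hs.2]⟩
  cases r with
  | zero =>
    -- For `r = 0` the Taylor sum is empty and the claim is boundedness.
    obtain ⟨C, hC⟩ := isCompact_Icc.exists_bound_of_continuousOn hg.continuousOn
    refine ⟨C, (norm_nonneg _).trans (hC t₀ ⟨le_rfl, hab⟩), 0, fun s hs => ?_⟩
    simpa using hC _ (hmem s hs)
  | succ n =>
    obtain ⟨C, hC⟩ := exists_taylor_mean_remainder_bound (n := n) hab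
      (hg.of_le (by exact_mod_cast le_top))
    refine ⟨|C|, abs_nonneg _, fun k =>
      ((k.factorial : ℝ)⁻¹) • iteratedDerivWithin k g (Icc t₀ (t₀ + δ)) t₀, fun s hs => ?_⟩
    have h := hC _ (hmem s hs)
    rw [taylor_within_apply] at h
    simp only [add_sub_cancel_left] at h
    simp only [smul_smul, mul_comm (_ ^ _) (Nat.cast _)⁻¹]
    exact h.trans (mul_le_mul_of_nonneg_right (le_abs_self C) (pow_nonneg hs.1 _))

/-! ### Rescaling to the unit interval and absorption estimates. -/

section UnitInterval

variable {E : Type*} [NormedAddCommGroup E] [NormedSpace ℝ E]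

theorem norm_le_of_hasDerivWithinAt_Icc_zero_one {d d' : ℝ → E} {a : ℝ}
    (hd : ∀ c ∈ Icc (0 : ℝ) 1, HasDerivWithinAt d (d' c) (Icc 0 1) c) (h0 : d 0 = 0)
    (hb : ∀ c ∈ Icc (0 : ℝ) 1, ‖d' c‖ ≤ a) : ∀ c ∈ Icc (0 : ℝ) 1, ‖d c‖ ≤ a := by
  intro c hc
  have h := (convex_Icc (0 : ℝ) 1).norm_image_sub_le_of_norm_hasDerivWithin_le hd hb
    (left_mem_Icc.2 zero_le_one) hc
  rw [h0, sub_zero, sub_zero, Real.norm_eq_abs, abs_of_nonneg hc.1] at h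
  have ha : 0 ≤ a := (norm_nonneg _).trans (hb c hc)
  exact h.trans (mul_le_of_le_one_right ha hc.2)

/-- If the derivative of a function vanishing at `0` is at most `a` plus half of the supremum of
the function, then the function is at most `2 * a`. -/
theorem norm_le_two_mul_of_hasDerivWithinAt_Icc_zero_one {d d' : ℝ → E} {a k : ℝ}
    (hd : ∀ c ∈ Icc (0 : ℝ) 1, HasDerivWithinAt d (d' c) (Icc 0 1) c) (h0 : d 0 = 0)
    (hk : k ≤ 1 / 2)
    (hb : ∀ S, 0 ≤ S → (∀ c ∈ Icc (0 : ℝ) 1, ‖d c‖ ≤ S) →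
      ∀ c ∈ Icc (0 : ℝ) 1, ‖d' c‖ ≤ a + k * S) :
    ∀ c ∈ Icc (0 : ℝ) 1, ‖d c‖ ≤ 2 * a := by
  have hcont : ContinuousOn d (Icc 0 1) := fun c hc => (hd c hc).continuousWithinAt
  obtain ⟨c₁, hc₁, hmax⟩ := isCompact_Icc.exists_isMaxOn (nonempty_Icc.2 (zero_le_one' ℝ))
    hcont.norm
  have hS : ∀ c ∈ Icc (0 : ℝ) 1, ‖d c‖ ≤ ‖d c₁‖ := fun c hc => hmax hc
  have h := norm_le_of_hasDerivWithinAt_Icc_zero_one hd h0 (hb _ (norm_nonneg _) hS) c₁ hc₁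
  intro c hc
  have := hS c hc
  nlinarith [norm_nonneg (d c₁)]

theorem add_mul_mem_Icc {t₀ h c : ℝ} (hh : 0 < h) (hc : c ∈ Icc (0 : ℝ) 1) :
    t₀ + c * h ∈ Icc t₀ (t₀ + h) :=
  ⟨by nlinarith [hc.1], by nlinarith [hc.2]⟩

theorem HasDerivWithinAt.comp_add_mul_Icc {u : ℝ → E} {D : E} {t₀ h c : ℝ} (hh : 0 < h)
    (hu : HasDerivWithinAt u D (Icc t₀ (t₀ + h)) (t₀ + c * h)) :
    HasDerivWithinAt (fun c => u (t₀ + c * h)) (h • D) (Icc 0 1) c := by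
  have hin : HasDerivWithinAt (fun c : ℝ => t₀ + c * h) h (Icc 0 1) c := by
    simpa using (((hasDerivAt_id c).mul_const h).const_add t₀).hasDerivWithinAt
  exact hu.scomp c hin fun x hx => add_mul_mem_Icc hh hx

theorem exists_add_mul_eq_of_mem_Icc {t₀ h t : ℝ} (hh : 0 < h) (ht : t ∈ Icc t₀ (t₀ + h)) :
    ∃ c ∈ Icc (0 : ℝ) 1, t₀ + c * h = t := by
  refine ⟨(t - t₀) / h, ⟨div_nonneg (by linarith [ht.1]) hh.le, ?_⟩, ?_⟩
  · rw [div_le_one hh]; linarith [ht.2]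
  · field_simp; ring

end UnitInterval

/-! ### Existence and uniqueness for the truncated problem. -/

open Polynomial in
theorem Polynomial.exists_derivative_eq (p : ℝ[X]) :
    ∃ q : ℝ[X], derivative q = p ∧ q.eval 0 = 0 ∧ q.natDegree ≤ p.natDegree + 1 := by
  refine ⟨∑ i ∈ Finset.range (p.natDegree + 1), C (p.coeff i / (i + 1)) * X ^ (i + 1), ?_, ?_, ?_⟩
  · conv_rhs => rw [p.as_sum_range_C_mul_X_pow]
    rw [derivative_sum]
    refine Finset.sum_congr rfl fun i _ => ?_
    have : ((i : ℝ) + 1) ≠ 0 := by positivity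
    rw [derivative_C_mul_X_pow]
    simp [this]
  · simp [eval_finsetSum]
  · refine natDegree_sum_le_of_forall_le _ _ fun i hi => ?_
    refine (natDegree_C_mul_X_pow_le _ _).trans ?_
    have := Finset.mem_range.1 hi
    omega

open NNReal in
/-- The Legendre coefficients of the truncated problem exist, for a globally Lipschitz vector field
and a small step. -/
theorem exists_legendre_coefficients {E : Type*} [NormedAddCommGroup E] [NormedSpace ℝ E]
    [CompleteSpace E] (r : ℕ) (L : ℝ≥0) (Q : ℕ → Polynomial ℝ) :
    ∃ h₁ : ℝ, 0 < h₁ ∧ ∀ (g : E → E), LipschitzWith L g → ∀ (y₀ : E) (h : ℝ), 0 < h → h ≤ h₁ →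
      ∃ γ : Fin r → E, ∀ j : Fin r, γ j =
        ∫ τ in (0 : ℝ)..1, (legendreHat j).eval τ • g (y₀ + h • ∑ i : Fin r, (Q i).eval τ • γ i) := by
  choose b hb0 hb using exists_abs_legendreHat_le
  have hq : ∀ j, ∃ q, ∀ c ∈ Icc (0 : ℝ) 1, ‖(Q j).eval c‖ ≤ q := fun j =>
    isCompact_Icc.exists_bound_of_continuousOn (Q j).continuous.continuousOn
  choose q hq using hq
  have hq0 : ∀ j, 0 ≤ q j := fun j => (norm_nonneg _).trans (hq j 0 (by simp))
  set β : ℝ := ∑ j : Fin r, b j with hβ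
  set σ : ℝ := ∑ j : Fin r, q j with hσ
  have hβ0 : 0 ≤ β := Finset.sum_nonneg fun j _ => hb0 j
  have hσ0 : 0 ≤ σ := Finset.sum_nonneg fun j _ => hq0 j
  -- The coefficient map has Lipschitz constant at most `h * β * L * σ` in the sup metric; this step
  -- size makes it at most `1 / 2`.
  refine ⟨1 / (2 * (β * L * σ + 1)), by positivity, fun g hg y₀ h hh hle => ?_⟩
  have hsmall : β * (L * (h * σ)) ≤ 1 / 2 := by
    rw [le_div_iff₀ (by positivity)] at hle
    nlinarith
  let Φ : (Fin r → E) → (Fin r → E) := fun γ j =>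
    ∫ τ in (0 : ℝ)..1, (legendreHat j).eval τ • g (y₀ + h • ∑ i : Fin r, (Q i).eval τ • γ i)
  have hcont : ∀ γ : Fin r → E,
      Continuous fun τ : ℝ => g (y₀ + h • ∑ i : Fin r, (Q i).eval τ • γ i) := fun γ =>
    hg.continuous.comp (by fun_prop)
  have hΦ : ContractingWith (1 / 2) Φ := by
    refine ⟨by norm_num, LipschitzWith.of_dist_le_mul fun γ γ' => ?_⟩
    refine (dist_pi_le_iff (by positivity)).2 fun j => ?_
    rw [dist_eq_norm]
    have e : Φ γ j - Φ γ' j = ∫ τ in (0 : ℝ)..1, (legendreHat j).eval τ •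
        (g (y₀ + h • ∑ i : Fin r, (Q i).eval τ • γ i) -
          g (y₀ + h • ∑ i : Fin r, (Q i).eval τ • γ' i)) := by
      simp only [smul_sub]
      rw [intervalIntegral.integral_sub (intervalIntegrable_eval_smul _ (hcont γ).continuousOn)
        (intervalIntegrable_eval_smul _ (hcont γ').continuousOn)]
    have hle : ∀ τ ∈ Icc (0 : ℝ) 1, ‖g (y₀ + h • ∑ i : Fin r, (Q i).eval τ • γ i) -
          g (y₀ + h • ∑ i : Fin r, (Q i).eval τ • γ' i)‖ ≤ L * (h * σ) * dist γ γ' := by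
      intro τ hτ
      refine (hg.norm_sub_le _ _).trans ?_
      rw [add_sub_add_left_eq_sub, ← smul_sub, ← Finset.sum_sub_distrib, norm_smul,
        Real.norm_of_nonneg hh.le, mul_assoc, mul_assoc]
      gcongr
      rw [hσ, Finset.sum_mul]
      refine (norm_sum_le _ _).trans (Finset.sum_le_sum fun i _ => ?_)
      rw [← smul_sub, norm_smul, ← dist_eq_norm]
      exact mul_le_mul (hq i τ hτ) (dist_le_pi_dist γ γ' i) dist_nonneg (hq0 i)
    rw [e]
    refine (norm_integral_legendreHat_smul_le (hb0 j) (hb j) hle).trans ?_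
    have hbj : b j ≤ β := Finset.single_le_sum (f := fun j : Fin r => b j)
      (fun i _ => hb0 i) (Finset.mem_univ j)
    have hd : 0 ≤ dist γ γ' := dist_nonneg
    calc b j * (L * (h * σ) * dist γ γ') ≤ β * (L * (h * σ) * dist γ γ') := by gcongr
      _ = β * (L * (h * σ)) * dist γ γ' := by ring
      _ ≤ 1 / 2 * dist γ γ' := by gcongr
      _ = ((1 / 2 : ℝ≥0) : ℝ) * dist γ γ' := by norm_num
  exact ⟨hΦ.fixedPoint Φ, fun j => (congrFun hΦ.fixedPoint_isFixedPt j).symm⟩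

section SolvesTruncated

variable {m r : ℕ} {f : EuclideanSpace ℝ (Fin m) → EuclideanSpace ℝ (Fin m)}
  {K : Set (EuclideanSpace ℝ (Fin m))} {t₀ h : ℝ} {y₀ : EuclideanSpace ℝ (Fin m)}

theorem SolvesTruncated.hasDerivWithinAt {ω : ℝ → EuclideanSpace ℝ (Fin m)} (hh : 0 < h)
    (hω : SolvesTruncated f K r t₀ h y₀ ω) {c : ℝ} (hc : c ∈ Icc (0 : ℝ) 1) :
    HasDerivWithinAt (fun c => ω (t₀ + c * h))
      (h • legendreProj r (fun τ => f (ω (t₀ + τ * h))) c) (Icc 0 1) c :=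
  (hω.deriv_eq c hc).comp_add_mul_Icc hh

theorem SolvesTruncated.continuousOn {ω : ℝ → EuclideanSpace ℝ (Fin m)} (hh : 0 < h)
    (hω : SolvesTruncated f K r t₀ h y₀ ω) :
    ContinuousOn (fun c => ω (t₀ + c * h)) (Icc 0 1) :=
  fun _ hc => (hω.hasDerivWithinAt hh hc).continuousWithinAt

/-- A solution of the truncated problem with a small step stays close to its initial value. -/
theorem SolvesTruncated.norm_sub_le {ω : ℝ → EuclideanSpace ℝ (Fin m)} {B M : ℝ} (hh : 0 < h)
    (hω : SolvesTruncated f K r t₀ h y₀ ω) (hM : ∀ x ∈ K, ‖f x‖ ≤ M)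
    (hB : ∀ (g : ℝ → EuclideanSpace ℝ (Fin m)) (M : ℝ), (∀ τ ∈ Icc (0 : ℝ) 1, ‖g τ‖ ≤ M) →
      ∀ c ∈ Icc (0 : ℝ) 1, ‖legendreProj r g c‖ ≤ B * M) {c : ℝ} (hc : c ∈ Icc (0 : ℝ) 1) :
    ‖ω (t₀ + c * h) - y₀‖ ≤ h * (B * M) := by
  refine norm_le_of_hasDerivWithinAt_Icc_zero_one
    (d := fun c => ω (t₀ + c * h) - y₀) (fun c hc => (hω.hasDerivWithinAt hh hc).sub_const y₀)
    (by simp [hω.initial]) (fun c hc => ?_) c hc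
  rw [norm_smul, Real.norm_of_nonneg hh.le]
  gcongr
  exact hB _ _ (fun τ hτ => hM _ (hω.mapsTo _ (add_mul_mem_Icc hh hτ))) c hc

-- The difference of two solutions vanishes at `0` and has derivative at most half its own supremum,
-- so it is zero.
open NNReal in
theorem SolvesTruncated.eqOn {v ω : ℝ → EuclideanSpace ℝ (Fin m)} {B : ℝ} {L : ℝ≥0} (hh : 0 < h)
    {S : Set (EuclideanSpace ℝ (Fin m))} (hL : LipschitzOnWith L f S)
    (hv : SolvesTruncated f K r t₀ h y₀ v) (hω : SolvesTruncated f K r t₀ h y₀ ω)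
    (hvS : ∀ c ∈ Icc (0 : ℝ) 1, v (t₀ + c * h) ∈ S) (hωS : ∀ c ∈ Icc (0 : ℝ) 1, ω (t₀ + c * h) ∈ S)
    (hB : ∀ (g : ℝ → EuclideanSpace ℝ (Fin m)) (M : ℝ), (∀ τ ∈ Icc (0 : ℝ) 1, ‖g τ‖ ≤ M) →
      ∀ c ∈ Icc (0 : ℝ) 1, ‖legendreProj r g c‖ ≤ B * M) (hBL : h * (B * L) ≤ 1 / 2) :
    EqOn v ω (Icc t₀ (t₀ + h)) := by
  have key := norm_le_two_mul_of_hasDerivWithinAt_Icc_zero_one (a := 0)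
    (d := fun c => v (t₀ + c * h) - ω (t₀ + c * h))
    (fun c hc => (hv.hasDerivWithinAt hh hc).sub (hω.hasDerivWithinAt hh hc))
    (by simp [hω.initial, hv.initial]) hBL (fun S' _ hS c hc => ?_)
  · intro t ht
    obtain ⟨c, hc, rfl⟩ := exists_add_mul_eq_of_mem_Icc hh ht
    have := key c hc
    rw [mul_zero] at this
    exact sub_eq_zero.1 (norm_le_zero_iff.1 this)
  · rw [← smul_sub, ← legendreProj_sub r (g₁ := fun τ => f (v (t₀ + τ * h)))
      (g₂ := fun τ => f (ω (t₀ + τ * h))) (hL.continuousOn.comp (hv.continuousOn hh) hvS)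
      (hL.continuousOn.comp (hω.continuousOn hh) hωS), norm_smul, Real.norm_of_nonneg hh.le,
      zero_add, mul_assoc, mul_assoc]
    gcongr
    refine hB _ _ (fun τ hτ => ?_) c hc
    refine (hL.norm_sub_le (hvS τ hτ) (hωS τ hτ)).trans ?_
    gcongr
    exact hS τ hτ

open NNReal in
theorem exists_solvesTruncated (r : ℕ) (t₀ : ℝ) {ρ : ℝ} {L : ℝ≥0} (hρ : 0 < ρ)
    (hL : LipschitzOnWith L f (Metric.closedBall y₀ ρ)) (hK : Metric.closedBall y₀ ρ ⊆ K) :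
    ∃ h₁ : ℝ, 0 < h₁ ∧ ∀ h : ℝ, 0 < h → h ≤ h₁ →
      ∃ ω, SolvesTruncated f K r t₀ h y₀ ω ∧ IsPolynomialOn r t₀ (t₀ + h) ω := by
  -- The contraction needs a globally Lipschitz field. The problem is solved for an extension `g`,
  -- and the solution is then shown to stay in the ball where `g = f`.
  obtain ⟨g, hg, hgf⟩ := hL.extend_finite_dimension
  set L' := lipschitzExtensionConstant (EuclideanSpace ℝ (Fin m)) * L with hL'
  choose Q hQd hQ0 hQn using fun j => (legendreHat j).exists_derivative_eq
  obtain ⟨B, hB0, hB⟩ := exists_norm_legendreProj_le (EuclideanSpace ℝ (Fin m)) r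
  obtain ⟨h₁, hh₁, hγ⟩ := exists_legendre_coefficients (E := EuclideanSpace ℝ (Fin m)) r L' Q
  set G := ‖g y₀‖ with hG
  refine ⟨min h₁ (min (1 / (2 * (B * L' + 1))) (ρ / (2 * (B * G + 1)))), by positivity,
    fun h hh hle => ?_⟩
  obtain ⟨hle1, hle2, hle3⟩ : h ≤ h₁ ∧ h ≤ 1 / (2 * (B * L' + 1)) ∧ h ≤ ρ / (2 * (B * G + 1)) := by
    simpa using hle
  obtain ⟨γ, hγ⟩ := hγ g hg y₀ h hh hle1
  have hBL : h * (B * L') ≤ 1 / 2 := by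
    rw [le_div_iff₀ (by positivity)] at hle2
    nlinarith
  have hBG : 2 * (h * (B * G)) ≤ ρ := by
    rw [le_div_iff₀ (by positivity)] at hle3
    nlinarith
  set ω : ℝ → EuclideanSpace ℝ (Fin m) := fun t =>
    y₀ + h • ∑ i : Fin r, (Q i).eval ((t - t₀) / h) • γ i with hω
  have hωs : ∀ c, ω (t₀ + c * h) = y₀ + h • ∑ i : Fin r, (Q i).eval c • γ i := fun c => by
    simp [hω, hh.ne']
  have hproj : ∀ c, legendreProj r (fun τ => g (ω (t₀ + τ * h))) c =
      ∑ i : Fin r, (legendreHat i).eval c • γ i := fun c => by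
    simp only [legendreProj, hωs, Finset.sum_range, ← hγ]
  have hωd : ∀ c, HasDerivAt ω (∑ i : Fin r, (legendreHat i).eval c • γ i) (t₀ + c * h) := by
    intro c
    have hin : HasDerivAt (fun t : ℝ => (t - t₀) / h) (1 / h) (t₀ + c * h) :=
      ((hasDerivAt_id _).sub_const t₀).div_const h
    have hc : (t₀ + c * h - t₀) / h = c := by field_simp; ring
    have hi : ∀ i : Fin r, HasDerivAt (fun t : ℝ => (Q i).eval ((t - t₀) / h) • γ i)
        (((legendreHat i).eval c * (1 / h)) • γ i) (t₀ + c * h) := fun i => by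
      have hQi := (Q i).hasDerivAt ((t₀ + c * h - t₀) / h)
      rw [hQd, hc] at hQi
      exact (HasDerivAt.comp _ (by rwa [hc]) hin).smul_const (γ i)
    have hsum := ((HasDerivAt.fun_sum fun i (_ : i ∈ Finset.univ) => hi i).const_smul h).const_add y₀
    have e : h • ∑ i : Fin r, ((legendreHat i).eval c * (1 / h)) • γ i =
        ∑ i : Fin r, (legendreHat i).eval c • γ i := by
      rw [Finset.smul_sum]
      refine Finset.sum_congr rfl fun i _ => ?_
      rw [smul_smul]
      congr 1
      field_simp
    rwa [e] at hsum
  have hω0 : ω t₀ = y₀ := by simp [hω, hQ0]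
  have hball : ∀ c ∈ Icc (0 : ℝ) 1, ω (t₀ + c * h) ∈ Metric.closedBall y₀ ρ := by
    intro c hc
    rw [mem_closedBall_iff_norm]
    refine le_trans ?_ hBG
    -- If `ω` stays within `S` of `y₀`, then `g` along it is at most `G + L' * S`; the `S` term is
    -- absorbed since `h * (B * L') ≤ 1 / 2`.
    refine norm_le_two_mul_of_hasDerivWithinAt_Icc_zero_one
      (d := fun c => ω (t₀ + c * h) - y₀) (fun c hc =>
        ((hωd c).hasDerivWithinAt.comp_add_mul_Icc hh).sub_const y₀) (by simp [hω0]) hBL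
      (fun S hS0 hS c hc => ?_) c hc
    rw [← hproj, norm_smul, Real.norm_of_nonneg hh.le]
    calc _ ≤ h * (B * (G + L' * S)) := by
          gcongr
          refine hB _ _ (fun τ hτ => ?_) c hc
          have h1 := hg.norm_sub_le (ω (t₀ + τ * h)) y₀
          have h2 : (L' : ℝ) * ‖ω (t₀ + τ * h) - y₀‖ ≤ L' * S := by
            gcongr; exact hS τ hτ
          have h3 := norm_le_norm_add_norm_sub' (g (ω (t₀ + τ * h))) (g y₀)
          linarith
      _ = _ := by ring
  have hfg : legendreProj r (fun τ => f (ω (t₀ + τ * h))) =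
      legendreProj r (fun τ => g (ω (t₀ + τ * h))) :=
    legendreProj_congr r fun τ hτ => hgf (hball τ hτ)
  refine ⟨ω, ⟨hω0, fun t ht => ?_, fun c hc => ?_⟩, ?_⟩
  · obtain ⟨c, hc, rfl⟩ := exists_add_mul_eq_of_mem_Icc hh ht
    exact hK (hball c hc)
  · have h2 := (hωd c).hasDerivWithinAt (s := Icc t₀ (t₀ + h))
    rw [← hproj, ← hfg] at h2
    exact h2
  · refine ⟨fun k => Polynomial.C (y₀ k) + Polynomial.C h * ∑ i : Fin r,
      Polynomial.C (γ i k) * (Q i).comp (Polynomial.C (1 / h) * (Polynomial.X - Polynomial.C t₀)),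
      fun k => ?_, fun t _ k => ?_⟩
    · refine Polynomial.natDegree_add_le_of_degree_le (by simp) ?_
      refine (Polynomial.natDegree_C_mul_le _ _).trans ?_
      refine Polynomial.natDegree_sum_le_of_forall_le _ _ fun i _ => ?_
      refine (Polynomial.natDegree_C_mul_le _ _).trans ?_
      have h1 : (Polynomial.C (1 / h) * (Polynomial.X - Polynomial.C t₀)).natDegree ≤ 1 :=
        (Polynomial.natDegree_C_mul_le _ _).trans (Polynomial.natDegree_X_sub_C_le _)
      have h2 := hQn i
      rw [natDegree_legendreHat] at h2
      calc _ ≤ (Q i).natDegree * 1 :=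
            Polynomial.natDegree_comp_le.trans (Nat.mul_le_mul_left _ h1)
        _ ≤ r := by have := i.2; omega
    · simp only [hω, PiLp.add_apply, PiLp.smul_apply, WithLp.ofLp_sum, Finset.sum_apply,
        Polynomial.eval_add, Polynomial.eval_mul, Polynomial.eval_finsetSum, Polynomial.eval_C,
        Polynomial.eval_comp, Polynomial.eval_sub, Polynomial.eval_X, smul_eq_mul]
      congr 2
      refine Finset.sum_congr rfl fun i _ => ?_
      rw [mul_comm (γ i k), div_eq_inv_mul, one_div]

end SolvesTruncated

/-! ### The order `2 * r + 1` error estimate. -/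

section ErrorEstimate

variable {E : Type*} [NormedAddCommGroup E] [NormedSpace ℝ E]

theorem hasDerivWithinAt_integral_Icc [CompleteSpace E] {g : ℝ → E} {a b c : ℝ}
    (hg : ContinuousOn g (Icc a b)) (hc : c ∈ Icc a b) :
    HasDerivWithinAt (fun u => ∫ x in a..u, g x) (g c) (Icc a b) c := by
  have : Fact (c ∈ Icc a b) := ⟨hc⟩
  refine intervalIntegral.integral_hasDerivWithinAt_right ?_
    (hg.stronglyMeasurableAtFilter_nhdsWithin measurableSet_Icc c) (hg c hc)
  exact (hg.mono (uIcc_subset_Icc (left_mem_Icc.2 (hc.1.trans hc.2)) hc)).intervalIntegrable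

open NNReal in
theorem Convex.norm_sub_sub_fderiv_le {f : E → E} {S : Set E} {L : ℝ≥0} (hS : Convex ℝ S)
    (hf : ∀ x ∈ S, DifferentiableAt ℝ f x) (hL : LipschitzOnWith L (fderiv ℝ f) S) {x z : E}
    (hx : x ∈ S) (hz : z ∈ S) : ‖f z - f x - fderiv ℝ f x (z - x)‖ ≤ L * ‖z - x‖ ^ 2 := by
  have hseg : segment ℝ x z ⊆ S := hS.segment_subset hx hz
  have h := (convex_segment x z).norm_image_sub_le_of_norm_fderiv_le' (f := f)
    (φ := fderiv ℝ f x) (C := L * ‖z - x‖) (fun u hu => hf u (hseg hu)) (fun u hu => ?_)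
    (left_mem_segment ℝ x z) (right_mem_segment ℝ x z)
  · exact h.trans_eq (by ring)
  · refine (hL.norm_sub_le (hseg hu) hx).trans ?_
    gcongr
    exact norm_sub_le_of_mem_segment hu

theorem norm_le_two_mul_of_norm_sub_one_le {T : E →L[ℝ] E} (hT : ‖T - 1‖ ≤ 1 / 2) (v : E) :
    ‖v‖ ≤ 2 * ‖T v‖ := by
  have h1 : ‖(T - 1) v‖ ≤ 1 / 2 * ‖v‖ := (T - 1).le_of_opNorm_le hT v
  have h2 : v = T v - (T - 1) v := by simp
  have h3 : ‖v‖ ≤ ‖T v‖ + ‖(T - 1) v‖ := by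
    conv_lhs => rw [h2]
    exact norm_sub_le _ _
  linarith

theorem norm_le_two_of_norm_sub_one_le {T : E →L[ℝ] E} (hT : ‖T - 1‖ ≤ 1 / 2) : ‖T‖ ≤ 2 := by
  have h1 : ‖(1 : E →L[ℝ] E)‖ ≤ 1 := ContinuousLinearMap.norm_id_le
  have h2 := norm_le_norm_add_norm_sub' T 1
  linarith

/-- Quasi-optimality: the projection fixes the polynomial with coefficients `a`, so the residual is
at most `1 + B` times the distance from `g` to it. -/
theorem norm_sub_legendreProj_le [CompleteSpace E] {r : ℕ} {B A D : ℝ} {φ g : ℝ → E}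
    (hB : ∀ (g : ℝ → E) (M : ℝ), (∀ τ ∈ Icc (0 : ℝ) 1, ‖g τ‖ ≤ M) →
      ∀ c ∈ Icc (0 : ℝ) 1, ‖legendreProj r g c‖ ≤ B * M)
    (hg : ContinuousOn g (Icc 0 1)) {a : ℕ → E}
    (hφ : ∀ c ∈ Icc (0 : ℝ) 1, ‖φ c - ∑ i ∈ Finset.range r, c ^ i • a i‖ ≤ A)
    (hD : ∀ c ∈ Icc (0 : ℝ) 1, ‖g c - φ c‖ ≤ D) :
    ∀ c ∈ Icc (0 : ℝ) 1, ‖g c - legendreProj r g c‖ ≤ (1 + B) * (D + A) := by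
  intro c hc
  have hq : Continuous fun c : ℝ => ∑ i ∈ Finset.range r, c ^ i • a i := by fun_prop
  have hb : ∀ c ∈ Icc (0 : ℝ) 1, ‖g c - ∑ i ∈ Finset.range r, c ^ i • a i‖ ≤ D + A :=
    fun c hc => by
      rw [← sub_add_sub_cancel _ (φ c)]
      exact (norm_add_le _ _).trans (add_le_add (hD c hc) (hφ c hc))
  have h1 := hB _ _ hb c hc
  rw [legendreProj_sub r hg hq.continuousOn, legendreProj_sum_pow_smul] at h1
  have h2 : g c - legendreProj r g c = (g c - ∑ i ∈ Finset.range r, c ^ i • a i) -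
      (legendreProj r g c - ∑ i ∈ Finset.range r, c ^ i • a i) := by abel
  rw [h2]
  linarith [norm_sub_le (g c - ∑ i ∈ Finset.range r, c ^ i • a i)
    (legendreProj r g c - ∑ i ∈ Finset.range r, c ^ i • a i), hb c hc]

open NNReal in
open scoped ContDiff in
/-- The truncated problem is superconvergent of order `2 * r` at the end of the step. -/
theorem exists_norm_sub_le_pow [CompleteSpace E] {f : E → E} {S : Set E} {L L₂ : ℝ≥0}
    (hS : Convex ℝ S) (hL : LipschitzOnWith L f S) (hf : ∀ x ∈ S, DifferentiableAt ℝ f x)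
    (hL₂ : LipschitzOnWith L₂ (fderiv ℝ f) S) {t₀ δ : ℝ} (hδ : 0 < δ) {y : ℝ → E}
    {Ψ : ℝ → E →L[ℝ] E}
    (hsol : ∀ t ∈ Icc t₀ (t₀ + δ), y t ∈ S ∧ HasDerivAt y (f (y t)) t ∧ ‖Ψ t - 1‖ ≤ 1 / 2 ∧
      HasDerivAt Ψ (-(Ψ t ∘L fderiv ℝ f (y t))) t)
    (hfy : ContDiffOn ℝ ∞ (fun t => f (y t)) (Icc t₀ (t₀ + δ)))
    (hΨ : ContDiffOn ℝ ∞ Ψ (Icc t₀ (t₀ + δ))) (r : ℕ) :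
    ∃ h₁ : ℝ, 0 < h₁ ∧ ∃ C : ℝ, ∀ h : ℝ, 0 < h → h ≤ h₁ → ∀ w : ℝ → E, w 0 = y t₀ →
      (∀ c ∈ Icc (0 : ℝ) 1, w c ∈ S) →
      (∀ c ∈ Icc (0 : ℝ) 1,
        HasDerivWithinAt w (h • legendreProj r (fun τ => f (w τ)) c) (Icc 0 1) c) →
      ‖y (t₀ + h) - w 1‖ ≤ C * h ^ (2 * r + 1) := by
  obtain ⟨B, hB0, hB⟩ := exists_norm_legendreProj_le E r
  obtain ⟨C₁, hC₁, a, ha⟩ := hfy.exists_norm_sub_sum_pow_smul_le hδ.le r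
  obtain ⟨C₂, hC₂, T, hT⟩ := hΨ.exists_norm_sub_sum_pow_smul_le hδ.le r
  -- `C₃` bounds `e` by `C₃ * h ^ (r + 1)`, and `C₄` bounds the residual by `C₄ * h ^ r`.
  set C₃ := 2 * ((1 + B) * C₁) with hC₃
  set C₄ := (1 + B) * (L * C₃ + C₁) with hC₄
  refine ⟨min δ (min 1 (1 / (2 * ((2 + B) * L + 1)))), by positivity,
    2 * (2 * L₂ * C₃ ^ 2 + C₂ * C₄), fun h hh hle w hw0 hwS hwd => ?_⟩
  obtain ⟨hle1, hle2, hle3⟩ : h ≤ δ ∧ h ≤ 1 ∧ h ≤ 1 / (2 * ((2 + B) * L + 1)) := by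
    simpa using hle
  have hk : h * ((2 + B) * L) ≤ 1 / 2 := by
    rw [le_div_iff₀ (by positivity)] at hle3
    nlinarith
  have hmem : ∀ c ∈ Icc (0 : ℝ) 1, t₀ + c * h ∈ Icc t₀ (t₀ + δ) := fun c hc =>
    Icc_subset_Icc_right (by linarith) (add_mul_mem_Icc hh hc)
  have hmem' : ∀ c ∈ Icc (0 : ℝ) 1, c * h ∈ Icc 0 δ := fun c hc =>
    ⟨by linarith [(hmem c hc).1], by linarith [(hmem c hc).2]⟩
  have hpow : ∀ c ∈ Icc (0 : ℝ) 1, (c * h) ^ r ≤ h ^ r := fun c hc =>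
    pow_le_pow_left₀ (hmem' c hc).1 (mul_le_of_le_one_left hh.le hc.2) r
  have hTaylor : ∀ c ∈ Icc (0 : ℝ) 1,
      ‖f (y (t₀ + c * h)) - ∑ i ∈ Finset.range r, c ^ i • (h ^ i • a i)‖ ≤ C₁ * h ^ r :=
    fun c hc => by
      simp only [smul_smul, ← mul_pow]
      exact (ha _ (hmem' c hc)).trans (mul_le_mul_of_nonneg_left (hpow c hc) hC₁)
  have hTaylorΨ : ∀ c ∈ Icc (0 : ℝ) 1,
      ‖Ψ (t₀ + c * h) - ∑ i ∈ Finset.range r, c ^ i • (h ^ i • T i)‖ ≤ C₂ * h ^ r :=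
    fun c hc => by
      simp only [smul_smul, ← mul_pow]
      exact (hT _ (hmem' c hc)).trans (mul_le_mul_of_nonneg_left (hpow c hc) hC₂)
  set e : ℝ → E := fun c => w c - y (t₀ + c * h) with he
  set g : ℝ → E := fun c => f (w c) with hg
  set R : ℝ → E := fun c => g c - legendreProj r g c with hR
  set N : ℝ → E := fun c => g c - f (y (t₀ + c * h)) - fderiv ℝ f (y (t₀ + c * h)) (e c) with hN
  have hgc : ContinuousOn g (Icc 0 1) :=
    hL.continuousOn.comp (fun c hc => (hwd c hc).continuousWithinAt) hwS
  have hRc : ContinuousOn R (Icc 0 1) := hgc.sub (continuous_legendreProj r g).continuousOn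
  have he0 : e 0 = 0 := by simp [he, hw0]
  have hlin : ∀ c, HasDerivAt (fun c : ℝ => t₀ + c * h) h c := fun c => by
    simpa using ((hasDerivAt_id c).mul_const h).const_add t₀
  have hed : ∀ c ∈ Icc (0 : ℝ) 1, HasDerivWithinAt e
      (h • (legendreProj r g c - f (y (t₀ + c * h)))) (Icc 0 1) c := fun c hc => by
    rw [smul_sub]
    exact (hwd c hc).sub ((hsol _ (hmem c hc)).2.1.scomp c (hlin c)).hasDerivWithinAt
  have hgφ : ∀ D, (∀ c ∈ Icc (0 : ℝ) 1, ‖e c‖ ≤ D) →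
      ∀ c ∈ Icc (0 : ℝ) 1, ‖g c - f (y (t₀ + c * h))‖ ≤ L * D := fun D hD c hc =>
    (hL.norm_sub_le (hwS c hc) (hsol _ (hmem c hc)).1).trans
      (mul_le_mul_of_nonneg_left (hD c hc) L.2)
  have hRle : ∀ D, (∀ c ∈ Icc (0 : ℝ) 1, ‖e c‖ ≤ D) →
      ∀ c ∈ Icc (0 : ℝ) 1, ‖R c‖ ≤ (1 + B) * (L * D + C₁ * h ^ r) := fun D hD =>
    norm_sub_legendreProj_le hB hgc hTaylor (hgφ D hD)
  have hele : ∀ c ∈ Icc (0 : ℝ) 1, ‖e c‖ ≤ C₃ * (h * h ^ r) := by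
    have := norm_le_two_mul_of_hasDerivWithinAt_Icc_zero_one
      (a := h * ((1 + B) * (C₁ * h ^ r))) hed he0 hk (fun D _ hD c hc => ?_)
    · intro c hc
      exact (this c hc).trans_eq (by rw [hC₃]; ring)
    · have h1 : legendreProj r g c - f (y (t₀ + c * h)) =
          (g c - f (y (t₀ + c * h))) - R c := by simp only [hR]; abel
      rw [h1, norm_smul, Real.norm_of_nonneg hh.le]
      calc _ ≤ h * (L * D + (1 + B) * (L * D + C₁ * h ^ r)) := by
            gcongr
            exact (norm_sub_le _ _).trans (add_le_add (hgφ D hD c hc) (hRle D hD c hc))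
        _ = _ := by ring
  have hRle' : ∀ c ∈ Icc (0 : ℝ) 1, ‖R c‖ ≤ C₄ * h ^ r := fun c hc => by
    refine (hRle _ hele c hc).trans ?_
    have hC₃0 : 0 ≤ C₃ := by positivity
    calc (1 + B) * (L * (C₃ * (h * h ^ r)) + C₁ * h ^ r)
        ≤ (1 + B) * (L * (C₃ * (1 * h ^ r)) + C₁ * h ^ r) := by gcongr
      _ = _ := by rw [hC₄]; ring
  have hNle : ∀ c ∈ Icc (0 : ℝ) 1, ‖N c‖ ≤ L₂ * (C₃ * (h * h ^ r)) ^ 2 := fun c hc => by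
    refine (hS.norm_sub_sub_fderiv_le hf hL₂ (hsol _ (hmem c hc)).1 (hwS c hc)).trans ?_
    gcongr
    exact hele c hc
  set P : ℝ → E →L[ℝ] E := fun c => ∑ i ∈ Finset.range r, c ^ i • (h ^ i • T i) with hP
  have hPc : Continuous P := by fun_prop
  have hPR : ContinuousOn (fun c => P c (R c)) (Icc 0 1) := hPc.continuousOn.clm_apply hRc
  have hPR0 : ∫ c in (0 : ℝ)..1, P c (R c) = 0 :=
    integral_sum_pow_smul_apply_sub_legendreProj r _ hgc
  -- The added integral vanishes at `c = 0` and, by orthogonality, at `c = 1`. In between it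
  -- replaces `Ψ R` by `(Ψ - P) R` in the derivative, so a pointwise bound suffices.
  have hzd : ∀ c ∈ Icc (0 : ℝ) 1, HasDerivWithinAt
      (fun c => Ψ (t₀ + c * h) (e c) + h • ∫ x in (0 : ℝ)..c, P x (R x))
      (h • (Ψ (t₀ + c * h) (N c) - (Ψ (t₀ + c * h) - P c) (R c))) (Icc 0 1) c := fun c hc => by
    have h1 := ((hsol _ (hmem c hc)).2.2.2.scomp c (hlin c)).hasDerivWithinAt (s := Icc 0 1)
    have h2 := (h1.clm_apply (hed c hc)).add ((hasDerivWithinAt_integral_Icc hPR hc).const_smul h)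
    refine h2.congr_deriv ?_
    have h3 : N c - R c =
        legendreProj r g c - f (y (t₀ + c * h)) - fderiv ℝ f (y (t₀ + c * h)) (e c) := by
      simp only [hN, hR]; abel
    have h4 : ∀ (A A' : E →L[ℝ] E) (u v : E), A u - (A - A') v = A (u - v) + A' v :=
      fun A A' u v => by rw [map_sub, sub_apply]; abel
    rw [h4, h3]
    simp only [FunLike.coe_smul, Pi.smul_apply, FunLike.coe_neg, Pi.neg_apply,
      ContinuousLinearMap.comp_apply, Function.comp_apply, map_smul, map_sub, smul_add, smul_sub,
      smul_neg]
    abel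
  have hz := norm_le_of_hasDerivWithinAt_Icc_zero_one
    (a := h * (2 * (L₂ * (C₃ * (h * h ^ r)) ^ 2) + C₂ * h ^ r * (C₄ * h ^ r))) hzd
    (by simp [he0]) (fun c hc => ?_) 1 (right_mem_Icc.2 zero_le_one)
  · simp only [hPR0, smul_zero, add_zero, one_mul] at hz
    have h1 := norm_le_two_mul_of_norm_sub_one_le
      (hsol (t₀ + h) (by simpa using hmem 1 (right_mem_Icc.2 zero_le_one))).2.2.1 (e 1)
    have h2 : ‖y (t₀ + h) - w 1‖ = ‖e 1‖ := by simp [he, norm_sub_rev]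
    rw [h2]
    refine h1.trans ((mul_le_mul_of_nonneg_left hz zero_le_two).trans ?_)
    -- The quadratic term carries two spare powers of `h`, discarded here.
    have h5 : h ^ 2 ≤ 1 := pow_le_one₀ hh.le hle2
    calc _ = 2 * (2 * L₂ * C₃ ^ 2 * h ^ 2 + C₂ * C₄) * h ^ (2 * r + 1) := by ring
      _ ≤ 2 * (2 * L₂ * C₃ ^ 2 * 1 + C₂ * C₄) * h ^ (2 * r + 1) := by gcongr
      _ = _ := by ring
  · rw [norm_smul, Real.norm_of_nonneg hh.le]
    gcongr
    refine (norm_sub_le _ _).trans (add_le_add ?_ ?_)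
    · exact ((Ψ (t₀ + c * h)).le_opNorm _).trans (mul_le_mul
        (norm_le_two_of_norm_sub_one_le (hsol _ (hmem c hc)).2.2.1) (hNle c hc)
        (norm_nonneg _) zero_le_two)
    · exact ((Ψ (t₀ + c * h) - P c).le_opNorm _).trans (mul_le_mul
        (hTaylorΨ c hc) (hRle' c hc) (norm_nonneg _) (by positivity))

end ErrorEstimate

/-! ### Uniqueness for the initial value problem. -/

section SolvesIVP

variable {m : ℕ} {f : EuclideanSpace ℝ (Fin m) → EuclideanSpace ℝ (Fin m)}
  {U : Set (EuclideanSpace ℝ (Fin m))} {t₀ h : ℝ} {y₀ : EuclideanSpace ℝ (Fin m)}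

theorem SolvesIVP.continuousOn {y : ℝ → EuclideanSpace ℝ (Fin m)}
    (hy : SolvesIVP f U t₀ h y₀ y) : ContinuousOn y (Icc t₀ (t₀ + h)) :=
  fun t ht => (hy.deriv_eq t ht).continuousWithinAt

theorem SolvesIVP.eqOn {y z : ℝ → EuclideanSpace ℝ (Fin m)} (hU : IsOpen U)
    (hf : ContDiffOn ℝ 1 f U) (hz : SolvesIVP f U t₀ h y₀ z) (hy : SolvesIVP f U t₀ h y₀ y) :
    EqOn z y (Icc t₀ (t₀ + h)) := by
  -- A competing solution is only known to lie in `U`. The union of both trajectories is compact, so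
  -- the locally Lipschitz `f` is Lipschitz on it.
  set S := z '' Icc t₀ (t₀ + h) ∪ y '' Icc t₀ (t₀ + h) with hS
  have hSc : IsCompact S := (isCompact_Icc.image_of_continuousOn hz.continuousOn).union
    (isCompact_Icc.image_of_continuousOn hy.continuousOn)
  have hSU : S ⊆ U := union_subset (image_subset_iff.2 hz.mapsTo) (image_subset_iff.2 hy.mapsTo)
  have hloc : LocallyLipschitzOn S f := fun x hx => by
    obtain ⟨L, t, ht, hL⟩ := (hf.contDiffAt (hU.mem_nhds (hSU hx))).exists_lipschitzOnWith
    exact ⟨L, t, mem_nhdsWithin_of_mem_nhds ht, hL⟩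
  obtain ⟨L, hL⟩ := hloc.exists_lipschitzOnWith_of_compact hSc
  have hder : ∀ u, SolvesIVP f U t₀ h y₀ u → ∀ t ∈ Ico t₀ (t₀ + h),
      HasDerivWithinAt u (f (u t)) (Ici t) t := fun u hu t ht =>
    (hu.deriv_eq t (Ico_subset_Icc_self ht)).mono_of_mem_nhdsWithin
      (Icc_mem_nhdsGE_of_mem ht)
  exact ODE_solution_unique_of_mem_Icc_right (v := fun _ => f) (s := fun _ => S) (K := L)
    (fun _ _ => hL) hz.continuousOn (hder z hz)
    (fun t ht => Or.inl (mem_image_of_mem _ (Ico_subset_Icc_self ht))) hy.continuousOn (hder y hy)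
    (fun t ht => Or.inr (mem_image_of_mem _ (Ico_subset_Icc_self ht)))
    (hz.initial.trans hy.initial.symm)

end SolvesIVP

/-! ### Assembly. -/

theorem theorem2p2 (m r : ℕ) (U : Set (EuclideanSpace ℝ (Fin m))) (hU : IsOpen U)
    (f : EuclideanSpace ℝ (Fin m) → EuclideanSpace ℝ (Fin m)) (hf : AnalyticOnNhd ℝ f U)
    (t₀ : ℝ) (y₀ : EuclideanSpace ℝ (Fin m))
    (K : Set (EuclideanSpace ℝ (Fin m))) (hK : IsCompact K) (hKU : K ⊆ U)
    (hy₀ : K ∈ nhds y₀) :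
    ∃ h₀ : ℝ, 0 < h₀ ∧ ∃ C : ℝ, ∀ h : ℝ, 0 < h → h ≤ h₀ →
      (∃ y, SolvesIVP f U t₀ h y₀ y ∧
        ∀ z, SolvesIVP f U t₀ h y₀ z → EqOn z y (Icc t₀ (t₀ + h))) ∧
      (∃ ω, SolvesTruncated f K r t₀ h y₀ ω ∧ IsPolynomialOn r t₀ (t₀ + h) ω ∧
        ∀ v, SolvesTruncated f K r t₀ h y₀ v → EqOn v ω (Icc t₀ (t₀ + h))) ∧
      ∀ y ω, SolvesIVP f U t₀ h y₀ y → SolvesTruncated f K r t₀ h y₀ ω →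
        ‖y (t₀ + h) - ω (t₀ + h)‖ ≤ C * h ^ (2 * r + 1) := by
  have hfU : ContDiffOn ℝ (⊤ : ℕ∞) f U := hf.contDiffOn hU.uniqueDiffOn
  have hfU1 : ContDiffOn ℝ 1 f U := hfU.of_le (by exact_mod_cast le_top)
  obtain ⟨ρ, hρ, hρK⟩ := Metric.nhds_basis_closedBall.mem_iff.1 hy₀
  set S := Metric.closedBall y₀ ρ with hS
  have hSU : S ⊆ U := hρK.trans hKU
  have hSconv : Convex ℝ S := convex_closedBall y₀ ρ
  obtain ⟨L, hL⟩ := (hfU1.mono hSU).exists_lipschitzOnWith one_ne_zero hSconv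
    (isCompact_closedBall y₀ ρ)
  have hf' : ContDiffOn ℝ 1 (fderiv ℝ f) U :=
    hfU.fderiv_of_isOpen hU (by norm_cast)
  obtain ⟨L₂, hL₂⟩ := (hf'.mono hSU).exists_lipschitzOnWith one_ne_zero hSconv
    (isCompact_closedBall y₀ ρ)
  obtain ⟨M, hM⟩ := hK.exists_bound_of_continuousOn (hfU.continuousOn.mono hKU)
  have hM0 : 0 ≤ M := (norm_nonneg _).trans (hM y₀ (mem_of_mem_nhds hy₀))
  obtain ⟨B, hB0, hB⟩ := exists_norm_legendreProj_le (EuclideanSpace ℝ (Fin m)) r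
  obtain ⟨δ, hδ, y, Ψ, hy0, hsol, hysm, hΨsm⟩ := exists_ode_solution_adjoint hU hfU
    (hKU (mem_of_mem_nhds hy₀)) t₀ (Metric.closedBall_mem_nhds y₀ hρ)
  obtain ⟨h₁, hh₁, hex⟩ := exists_solvesTruncated (K := K) r t₀ hρ hL hρK
  obtain ⟨h₂, hh₂, C, herr⟩ := exists_norm_sub_le_pow hSconv hL
    (fun x hx => (hf x (hSU hx)).differentiableAt) hL₂ hδ
    (fun t ht => ⟨(hsol t ht).1, (hsol t ht).2.2⟩)
    (hfU.comp hysm fun t ht => (hsol t ht).2.1) hΨsm r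
  -- `K` need not be convex. The bound with `M` forces every `K`-valued solution into the ball `S`,
  -- where the Lipschitz estimates hold; the last bound gives uniqueness.
  refine ⟨min (min δ (min h₁ h₂)) (min (ρ / (B * M + 1)) (1 / (2 * (B * L + 1)))), by positivity,
    C, fun h hh hle => ?_⟩
  simp only [le_min_iff] at hle
  obtain ⟨⟨hle1, hle2, hle3⟩, hle4, hle5⟩ := hle
  have hBM : h * (B * M) ≤ ρ := by
    rw [le_div_iff₀ (by positivity)] at hle4
    nlinarith
  have hBL : h * (B * L) ≤ 1 / 2 := by
    rw [le_div_iff₀ (by positivity)] at hle5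
    nlinarith
  have hsub : Icc t₀ (t₀ + h) ⊆ Icc t₀ (t₀ + δ) := Icc_subset_Icc_right (by linarith)
  have hy : SolvesIVP f U t₀ h y₀ y := ⟨hy0, fun t ht => (hsol t (hsub ht)).2.1,
    fun t ht => (hsol t (hsub ht)).2.2.1.hasDerivWithinAt⟩
  have hball : ∀ ω, SolvesTruncated f K r t₀ h y₀ ω →
      ∀ c ∈ Icc (0 : ℝ) 1, ω (t₀ + c * h) ∈ S := fun ω hω c hc =>
    mem_closedBall_iff_norm.2 ((hω.norm_sub_le hh hM hB hc).trans hBM)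
  refine ⟨⟨y, hy, fun z hz => hz.eqOn hU hfU1 hy⟩, ?_, fun z ω hz hω => ?_⟩
  · obtain ⟨ω, hω, hpoly⟩ := hex h hh hle2
    exact ⟨ω, hω, hpoly, fun v hv => hv.eqOn hh hL hω (hball v hv) (hball ω hω) hB hBL⟩
  · rw [hz.eqOn hU hfU1 hy (right_mem_Icc.2 (by linarith))]
    have := herr h hh hle3 (fun c => ω (t₀ + c * h)) (by simp [hω.initial, hy0]) (hball ω hω)
      (fun c hc => hω.hasDerivWithinAt hh hc)
    simpa using this
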